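/- Let $A$ be a non-empty set of actions, endowed with the discrete topology, let $A^{\mathbb N}$ carry the product topology, and let $u^1,u^2:A^{\mathbb N}\to\mathbb R$ be lower-semi-continuous payoff functions with finite range. The players choose actions alternately, with perfect information: after a finite history $h$ the player $i(h)$ moves, where $i(h)=1$ if $h$ has even length and $i(h)=2$ otherwise. A strategy of player $i$ assigns an action to every finite history at which $i$ moves; $p(\sigma^1,\sigma^2\mid h)$ is the play that starts with $h$ and then follows $(\sigma^1,\sigma^2)$, and $u^i(\sigma^1,\sigma^2\mid h)$ is the payoff of player $i$ at this play. The pair $(\sigma^1,\sigma^2)$ is a subgame-perfect $0$-equilibrium if, for every finite history $h$, no player $i$ can increase $u^i(\sigma^1,\sigma^2\mid h)$ by changing his own strategy only. For a real function $\alpha$ on finite histories, a play $p$ is called $\alpha$-viable at $h$ if $h$ is a prefix of $p$ and $u^{i(h')}(p)\ge\alpha(h')$ for every prefix $h'$ of $p$ that extends $h$. Define $\alpha_\xi(h)\in\mathbb R$ and $H_\xi(h)\subseteq A^{\mathbb N}$, for finite histories $h$ and ordinals $\xi\ge 1$, as follows. $\alpha_1(h)$ is the value of the subgame at $h$ for player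 $i(h)$, $$\alpha_1(h)=\max_{\sigma^{i(h)}}\min_{\sigma^{-i(h)}}u^{i(h)}(\sigma^1,\sigma^2\mid h)=\min_{\sigma^{-i(h)}}\max_{\sigma^{i(h)}}u^{i(h)}(\sigma^1,\sigma^2\mid h);$$ at successors, $$\alpha_{\xi+1}(h)=\max_{a\in A}\ \min_{p\in H_\xi(h,a)}u^{i(h)}(p),\qquad H_{\xi+1}(h)=\Big\{p\in\bigcup_{a\in A}H_\xi(h,a): u^{i(h)}(p)\ge\alpha_{\xi+1}(h)\Big\};$$ at limit ordinals $\alpha_\xi(h)=\max_{1\le\lambda<\xi}\alpha_\lambda(h)$; and for $\xi=1$ and for limit ordinals $\xi$, $H_\xi(h)$ is the set of all plays that are $\alpha_\xi$-viable at $h$. Then these sequences are well defined (the value $\alpha_1(h)$ exists and every $H_\xi(h)$ is non-empty), and there is an ordinal $\xi_*$ such that $\alpha_{\xi_*}(h)=\alpha_{\xi_*+1}(h)$ and $H_{\xi_*}(h)=H_{\xi_*+1}(h)$ for every finite history $h$. For every such $\xi_*$ and every play $p$: $p$ is the play $p(\sigma^1,\sigma^2\mid\emptyset)$ induced by some subgame-perfect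 $0$-equilibrium $(\sigma^1,\sigma^2)$ if and only if $p$ is $\alpha_{\xi_*}$-viable at the empty history $\emptyset$. -/

import Mathlib

/-! Two-player games of perfect information with a common action set `A`.
Players are the elements of `Fin 2`: `0` is the first player (who moves at histories of even
length), `1` is the second one. Finite histories are lists in chronological order, so `h ++ [a]`
is the history `h` followed by the action `a`; a play is a sequence `ℕ → A`. -/

namespace BorelGame

universe v

variable {A : Type v}

/-- The player who has to choose an action after the finite history `h`. -/
def mover (h : List A) : Fin 2 := if Even h.length then 0 else 1

/-- The strategies of player `i`: an action for each history at which `i` moves. -/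
def Strategy (A : Type v) (i : Fin 2) : Type v := {h : List A // mover h = i} → A

/-- A pair of strategies, one for each player. -/
def Profile (A : Type v) : Type v := (i : Fin 2) → Strategy A i

/-- The pair in which player `i` uses `s` and the other player uses his strategy in `σ`. -/
def Profile.deviate (σ : Profile A) (i : Fin 2) (s : Strategy A i) : Profile A :=
  Function.update σ i s

/-- The history reached from `h` after `n` further moves according to `σ`. -/
def histAfter (σ : Profile A) (h : List A) : ℕ → List A
  | 0 => h
  | n + 1 => histAfter σ h n ++ [σ (mover (histAfter σ h n)) ⟨histAfter σ h n, rfl⟩]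

theorem length_histAfter (σ : Profile A) (h : List A) (n : ℕ) :
    (histAfter σ h n).length = h.length + n := by
  induction n with
  | zero => rfl
  | succ n ih => simp only [histAfter, List.length_append, ih, List.length_singleton]; omega

/-- The play that starts with `h` and is then determined by `σ`. -/
def play (σ : Profile A) (h : List A) (t : ℕ) : A :=
  (histAfter σ h (t + 1))[t]'(by rw [length_histAfter]; omega)

/-- The finite history `h` is a prefix of the play `p`. -/
def IsPrefixOf (h : List A) (p : ℕ → A) : Prop :=
  ∀ (k : ℕ) (hk : k < h.length), h[k] = p k

/-- `σ` is a subgame-perfect `ε`-equilibrium for the payoff functions `u 0`, `u 1`. -/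
def IsSubgamePerfect (u : Fin 2 → (ℕ → A) → ℝ) (ε : ℝ) (σ : Profile A) : Prop :=
  ∀ (h : List A) (i : Fin 2) (s : Strategy A i),
    u i (play (σ.deviate i s) h) - ε ≤ u i (play σ h)

/-- `x` is the value at `h`, for the payoff of the player `i` who moves at `h`:
`x = max_s min_t u i (s, t | h) = min_t max_s u i (s, t | h)`, with `s` ranging over the strategies
of `i` and `t` over those of his opponent, all maxima and minima being attained.
The opponent's strategy is presented as a pair `τ`, whose `i`-th component is overridden
by `s` and so plays no role. -/
def IsValueAt (u : Fin 2 → (ℕ → A) → ℝ) (h : List A) (x : ℝ) : Prop :=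
  IsGreatest {y | ∃ s : Strategy A (mover h),
    IsLeast {z | ∃ τ : Profile A, z = u (mover h) (play (τ.deviate (mover h) s) h)} y} x ∧
  IsLeast {y | ∃ τ : Profile A,
    IsGreatest {z | ∃ s : Strategy A (mover h),
      z = u (mover h) (play (τ.deviate (mover h) s) h)} y} x

/-- The value at `h`, written as the max-min; see `IsValueAt` for the two-sided notion. -/
noncomputable def value (u : Fin 2 → (ℕ → A) → ℝ) (h : List A) : ℝ :=
  ⨆ s : Strategy A (mover h), ⨅ τ : Profile A,
    u (mover h) (play (τ.deviate (mover h) s) h)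

/-- The play `p` is `α`-viable at the finite history `h`. -/
def IsViable (u : Fin 2 → (ℕ → A) → ℝ) (α : List A → ℝ) (h : List A) (p : ℕ → A) : Prop :=
  IsPrefixOf h p ∧
    ∀ h' : List A, h <+: h' → IsPrefixOf h' p → α h' ≤ u (mover h') p

/-- The pair `(α, H)` of a real-valued function on finite histories and a function from finite
histories to sets of plays. -/
abbrev Stage (A : Type v) : Type v := (List A → ℝ) × (List A → Set (ℕ → A))

/-- The stage with a given `α` and with `H h` the set of all plays that are `α`-viable at `h`. -/
def viableStage (u : Fin 2 → (ℕ → A) → ℝ) (α : List A → ℝ) : Stage A :=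
  (α, fun h => {p | IsViable u α h p})

/-- `α_{ξ+1} h = max_a min {u i p | p ∈ H_ξ (h, a)}`, for `i` the player who moves at `h`. -/
noncomputable def nextAlpha (u : Fin 2 → (ℕ → A) → ℝ) (S : Stage A) (h : List A) : ℝ :=
  ⨆ a : A, sInf (u (mover h) '' S.2 (h ++ [a]))

/-- The stage at `ξ + 1` in terms of the one at `ξ`. -/
noncomputable def nextStage (u : Fin 2 → (ℕ → A) → ℝ) (S : Stage A) : Stage A :=
  (nextAlpha u S,
    fun h => {p | p ∈ (⋃ a : A, S.2 (h ++ [a])) ∧ nextAlpha u S h ≤ u (mover h) p})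

/-- The transfinite sequence of stages. It is indexed by all ordinals, from `0` on, so that the
first stage, with `α` the value, has index `0`. -/
noncomputable def stage (u : Fin 2 → (ℕ → A) → ℝ) (ξ : Ordinal.{v}) : Stage A :=
  Ordinal.limitRecOn ξ
    (viableStage u (value u))
    (fun _ S => nextStage u S)
    (fun ξ _ S => viableStage u (fun h => ⨆ l : Set.Iio ξ, (S l.1 l.2).1 h))

/-- The function `α_ξ`. -/
noncomputable def alpha (u : Fin 2 → (ℕ → A) → ℝ) (ξ : Ordinal.{v}) : List A → ℝ :=
  (stage u ξ).1

/-- The sets of plays `H_ξ h`. -/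
noncomputable def plays (u : Fin 2 → (ℕ → A) → ℝ) (ξ : Ordinal.{v}) : List A → Set (ℕ → A) :=
  (stage u ξ).2

/-- The two sequences are stable at `ξ`: nothing changes from `ξ` to `ξ + 1`. -/
def IsStableAt (u : Fin 2 → (ℕ → A) → ℝ) (ξ : Ordinal.{v}) : Prop :=
  ∀ h : List A, alpha u ξ h = alpha u (ξ + 1) h ∧ plays u ξ h = plays u (ξ + 1) h

end BorelGame

/-!
A play induced by a subgame-perfect equilibrium `σ` survives every stage: no deviation to an action
`a` at `h` improves on the continuation of `σ`, so the payoff of the mover there is at least the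
minimum over the surviving plays through `h ++ [a]` (`IsSubgamePerfect.mem_stage`). Conversely, if
after each action `a` at each history `h` there is an `α`-viable play that gives the mover at `h` at
most `α h`, then each `α`-viable play is an equilibrium play: departures from the current plan are
punished by such plays, and lower semicontinuity takes care of infinitely many departures
(`exists_isSubgamePerfect_of_isViable`). At a stable stage these punishments exist, because its
plays are viable (`IsStableAt.isViable`).

The difficulty is that the sets of surviving plays might become empty at limit ordinals. They do
not, because an equilibrium exists (`exists_isSubgamePerfect`). It comes from an auxiliary, slightly
simpler sequence `beta`, started at the least payoff. Call an action safe at level `ξ` if it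
guarantees `beta u ξ` to the mover at all plays viable at some lower level. Moving by safe actions,
the payoffs guaranteed to the two players can only grow, so by finiteness they are maximal at some
history `z`; all bounds of level `ξ` met on a safe path through `z` lie below these guarantees. The
guarantees hold at all plays viable at `z` at a single level `ζ < ξ`, and by induction there is such
a play with `ζ`-safe actions only. It is `ξ`-viable, and its actions are even safe at level `ξ`
(`exists_isViable_isSafe`). Being monotone, `beta` stabilizes, and the criterion above applies.

The value exists by the determinacy of open games (`exists_forall_lt_of_not_forces`), and the stages
stabilize since they are monotone; the first step of the monotonicity, from the value to the second
stage, uses an optimal strategy (`exists_forall_value_le`).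
-/

namespace BorelGame

universe v

variable {A : Type v}

/-! ### Histories and plays -/

/-- The history formed by the first `n` actions of the play `p`. -/
def segment (p : ℕ → A) (n : ℕ) : List A := (List.range n).map p

@[simp]
theorem length_segment (p : ℕ → A) (n : ℕ) : (segment p n).length = n := by simp [segment]

theorem segment_succ (p : ℕ → A) (n : ℕ) : segment p (n + 1) = segment p n ++ [p n] := by
  simp [segment, List.range_succ]

theorem isPrefixOf_iff {h : List A} {p : ℕ → A} : IsPrefixOf h p ↔ segment p h.length = h := by
  constructor
  · intro hp
    refine List.ext_getElem (by simp) fun k h1 h2 => ?_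
    simp [segment, hp k h2]
  · intro hp k hk
    have : (segment p h.length)[k]'(by simpa using hk) = h[k] := by simp only [hp]
    rw [← this]; simp [segment]

theorem isPrefixOf_segment (p : ℕ → A) (n : ℕ) : IsPrefixOf (segment p n) p := by
  rw [isPrefixOf_iff, length_segment]

theorem isPrefixOf_append_singleton {h : List A} {a : A} {p : ℕ → A} :
    IsPrefixOf (h ++ [a]) p ↔ IsPrefixOf h p ∧ p h.length = a := by
  simp only [isPrefixOf_iff, List.length_append, List.length_singleton, segment_succ]
  constructor
  · intro e
    have := List.append_inj' e rfl
    exact ⟨this.1, by simpa using this.2⟩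
  · rintro ⟨e, e'⟩
    rw [e, e']

theorem IsPrefixOf.of_prefix {g h : List A} {p : ℕ → A} (hp : IsPrefixOf h p) (hg : g <+: h) :
    IsPrefixOf g p := fun k hk => by
  rw [hg.getElem hk]; exact hp k _

theorem IsPrefixOf.prefix_of_length_le {g h : List A} {p : ℕ → A} (hg : IsPrefixOf g p)
    (hh : IsPrefixOf h p) (hl : g.length ≤ h.length) : g <+: h := by
  rw [List.prefix_iff_getElem]
  exact ⟨hl, fun k hk => by rw [hg k hk, hh k (by omega)]⟩

theorem IsPrefixOf.prefix_segment {h : List A} {p : ℕ → A} (hp : IsPrefixOf h p) {n : ℕ}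
    (hn : h.length ≤ n) : h <+: segment p n :=
  hp.prefix_of_length_le (isPrefixOf_segment p n) (by simpa using hn)

theorem exists_isPrefixOf [Nonempty A] (h : List A) : ∃ p : ℕ → A, IsPrefixOf h p :=
  ⟨fun k => h.getD k (Classical.arbitrary A), fun k hk => by simp [hk]⟩

/-- The action prescribed by `σ` at the history `h`, whoever moves there. -/
def Profile.act (σ : Profile A) (h : List A) : A := σ (mover h) ⟨h, rfl⟩

/-- The profile that prescribes the action `f h` at each history `h`. -/
def Profile.ofFun (f : List A → A) : Profile A := fun _ h => f h.1

@[simp]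
theorem Profile.act_ofFun (f : List A → A) (h : List A) : (Profile.ofFun f).act h = f h := rfl

theorem Profile.act_deviate_of_eq (σ : Profile A) {i : Fin 2} (s : Strategy A i) {h : List A}
    (hi : mover h = i) : (σ.deviate i s).act h = s ⟨h, hi⟩ := by
  subst hi
  exact congrFun (Function.update_self (β := Strategy A) _ s σ) _

theorem Profile.act_deviate_of_ne (σ : Profile A) {i : Fin 2} (s : Strategy A i) {h : List A}
    (hi : mover h ≠ i) : (σ.deviate i s).act h = σ.act h :=
  congrFun (Function.update_of_ne (β := Strategy A) hi s σ) _

theorem histAfter_succ (σ : Profile A) (h : List A) (n : ℕ) :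
    histAfter σ h (n + 1) = histAfter σ h n ++ [σ.act (histAfter σ h n)] := rfl

theorem histAfter_prefix (σ : Profile A) (h : List A) {m n : ℕ} (hmn : m ≤ n) :
    histAfter σ h m <+: histAfter σ h n := by
  induction n, hmn using Nat.le_induction with
  | base => exact List.prefix_rfl
  | succ n _ ih => rw [histAfter_succ]; exact ih.trans (List.prefix_append _ _)

theorem isPrefixOf_histAfter (σ : Profile A) (h : List A) (n : ℕ) :
    IsPrefixOf (histAfter σ h n) (play σ h) := by
  intro k hk
  unfold play
  rcases le_total n (k + 1) with hn | hn
  · exact (histAfter_prefix σ h hn).getElem hk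
  · exact ((histAfter_prefix σ h hn).getElem _).symm

theorem isPrefixOf_play (σ : Profile A) (h : List A) : IsPrefixOf h (play σ h) :=
  isPrefixOf_histAfter σ h 0

theorem histAfter_eq_segment (σ : Profile A) (h : List A) (n : ℕ) :
    histAfter σ h n = segment (play σ h) (h.length + n) := by
  have := isPrefixOf_iff.1 (isPrefixOf_histAfter σ h n)
  rw [length_histAfter] at this
  exact this.symm

theorem play_apply (σ : Profile A) (h : List A) {n : ℕ} (hn : h.length ≤ n) :
    play σ h n = σ.act (segment (play σ h) n) := by
  obtain ⟨k, rfl⟩ := Nat.exists_eq_add_of_le hn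
  have h1 := isPrefixOf_histAfter σ h (k + 1)
  rw [histAfter_succ, isPrefixOf_append_singleton, length_histAfter] at h1
  rw [h1.2, histAfter_eq_segment]

/-- The play induced by `σ` from `h` is the only one that extends `h` and obeys `σ` from then
on. -/
theorem play_eq_iff {σ : Profile A} {h : List A} {p : ℕ → A} :
    play σ h = p ↔ IsPrefixOf h p ∧ ∀ n, h.length ≤ n → p n = σ.act (segment p n) := by
  constructor
  · rintro rfl
    exact ⟨isPrefixOf_play σ h, fun n hn => play_apply σ h hn⟩
  · rintro ⟨hp, hs⟩
    have key : ∀ n, h.length ≤ n → segment (play σ h) n = segment p n := by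
      intro n hn
      induction n, hn using Nat.le_induction with
      | base => rw [isPrefixOf_iff.1 hp, isPrefixOf_iff.1 (isPrefixOf_play σ h)]
      | succ n hn ih => rw [segment_succ, segment_succ, hs n hn, play_apply σ h hn, ih]
    funext n
    have := key (h.length + n + 1) (by omega)
    have h1 := isPrefixOf_segment p (h.length + n + 1) n (by simp)
    have h2 := isPrefixOf_segment (play σ h) (h.length + n + 1) n (by simp)
    rw [← h1, ← h2]
    simp only [this]

theorem play_congr {σ τ : Profile A} {h : List A}
    (hst : ∀ g, h <+: g → σ.act g = τ.act g) : play σ h = play τ h := by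
  rw [play_eq_iff]
  refine ⟨isPrefixOf_play τ h, fun n hn => ?_⟩
  rw [hst _ ((isPrefixOf_play τ h).prefix_segment hn)]
  exact play_apply τ h hn

theorem play_append_act (σ : Profile A) (h : List A) : play σ (h ++ [σ.act h]) = play σ h := by
  rw [play_eq_iff]
  refine ⟨isPrefixOf_append_singleton.2 ⟨isPrefixOf_play σ h, ?_⟩, fun n hn =>
    play_apply σ h (by simp at hn; omega)⟩
  rw [play_apply σ h le_rfl, isPrefixOf_iff.1 (isPrefixOf_play σ h)]

theorem play_segment_play (σ : Profile A) (h : List A) {n : ℕ} (hn : h.length ≤ n) :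
    play σ (segment (play σ h) n) = play σ h := by
  rw [play_eq_iff]
  exact ⟨isPrefixOf_segment _ _, fun m hm => play_apply σ h (by simp at hm; omega)⟩

theorem IsViable.mono {u : Fin 2 → (ℕ → A) → ℝ} {α β : List A → ℝ} (hαβ : α ≤ β) {h : List A}
    {p : ℕ → A} (hp : IsViable u β h p) : IsViable u α h p :=
  ⟨hp.1, fun g hg hgp => (hαβ g).trans (hp.2 g hg hgp)⟩

theorem isViable_append_singleton {u : Fin 2 → (ℕ → A) → ℝ} {α : List A → ℝ} {h : List A}
    {a : A} {p : ℕ → A} :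
    IsViable u α (h ++ [a]) p ∧ α h ≤ u (mover h) p ↔ IsViable u α h p ∧ p h.length = a := by
  constructor
  · rintro ⟨hp, hα⟩
    obtain ⟨h1, h2⟩ := isPrefixOf_append_singleton.1 hp.1
    refine ⟨⟨h1, fun g hg hgp => ?_⟩, h2⟩
    rcases eq_or_ne h g with rfl | hne
    · exact hα
    · refine hp.2 g (hp.1.prefix_of_length_le hgp ?_) hgp
      have : h.length ≠ g.length := fun e => hne (hg.eq_of_length e)
      have := hg.length_le
      simp; omega
  · rintro ⟨hp, ha⟩
    exact ⟨⟨isPrefixOf_append_singleton.2 ⟨hp.1, ha⟩, fun g hg hgp =>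
      hp.2 g ((List.prefix_append _ _).trans hg) hgp⟩, hp.2 h List.prefix_rfl hp.1⟩

/-! ### From viable plays to equilibria -/

/-- The plan in force at a history that is given as a list in reverse chronological order. It begins
as `p₀`, and is replaced by `Q h a` whenever the action `a` taken at `h` departs from it. -/
def planRev (p₀ : ℕ → A) (Q : List A → A → ℕ → A) [DecidableEq A] : List A → ℕ → A
  | [] => p₀
  | a :: r => if planRev p₀ Q r r.length = a then planRev p₀ Q r else Q r.reverse a

/-- The plan in force at the history `h`; see `planRev`. -/
def plan (p₀ : ℕ → A) (Q : List A → A → ℕ → A) [DecidableEq A] (h : List A) : ℕ → A :=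
  planRev p₀ Q h.reverse

theorem plan_append_singleton (p₀ : ℕ → A) (Q : List A → A → ℕ → A) [DecidableEq A] (h : List A)
    (a : A) : plan p₀ Q (h ++ [a]) =
      if plan p₀ Q h h.length = a then plan p₀ Q h else Q h a := by
  simp only [plan, planRev, List.reverse_append, List.reverse_singleton, List.singleton_append,
    List.length_reverse, List.reverse_reverse]
  congr

/-- If, after each departure `a` at a history `h`, there is an `α`-viable play at which the
deviator gets at most `α h`, then every play that is `α`-viable at the empty history is induced by
an equilibrium: the players follow the current plan, and each departure is punished by switching to
such a play. The deviator's payoff at the current plan never increases along his deviations, and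
lower semicontinuity extends this to the limit of infinitely many deviations. -/
theorem exists_isSubgamePerfect_of_isViable [TopologicalSpace A] [DiscreteTopology A]
    {u : Fin 2 → (ℕ → A) → ℝ} (hlsc : ∀ i, LowerSemicontinuous (u i)) {α : List A → ℝ}
    (hα : ∀ (h : List A) (a : A), ∃ q, IsViable u α (h ++ [a]) q ∧ u (mover h) q ≤ α h)
    {p : ℕ → A} (hp : IsViable u α [] p) :
    ∃ σ : Profile A, IsSubgamePerfect u 0 σ ∧ play σ [] = p := by
  classical
  choose Q hQ hQα using hα
  set P := plan p Q with hPdef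
  have hstep : ∀ h a, P (h ++ [a]) = if P h h.length = a then P h else Q h a :=
    plan_append_singleton p Q
  have hviable : ∀ h, IsViable u α h (P h) := by
    intro h
    induction h using List.reverseRecOn with
    | nil => exact hp
    | append_singleton h a ih =>
      rw [hstep]
      split_ifs with hc
      · exact (isViable_append_singleton.2 ⟨ih, hc⟩).1
      · exact hQ h a
  have hseg : ∀ h n, h.length ≤ n → P (segment (P h) n) = P h := by
    intro h n hn
    induction n, hn using Nat.le_induction with
    | base => rw [isPrefixOf_iff.1 (hviable h).1]
    | succ n hn ih => rw [segment_succ, hstep, ih]; simp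
  let σ : Profile A := Profile.ofFun fun h => P h h.length
  have hplay : ∀ h, play σ h = P h := fun h =>
    play_eq_iff.2 ⟨(hviable h).1, fun n hn => by simp [σ, hseg h n hn]⟩
  refine ⟨σ, fun h i s => ?_, hplay []⟩
  rw [sub_zero, hplay]
  obtain ⟨r, hr⟩ : ∃ r, play (σ.deviate i s) h = r := ⟨_, rfl⟩
  rw [hr]
  obtain ⟨hhr, hact⟩ := play_eq_iff.1 hr
  -- Only player `i` departs from the plans along `r`, so a new plan punishes him.
  have hmono : ∀ n, h.length ≤ n → u i (P (segment r n)) ≤ u i (P h) := by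
    intro n hn
    induction n, hn using Nat.le_induction with
    | base => rw [isPrefixOf_iff.1 hhr]
    | succ n hn ih =>
      refine le_trans ?_ ih
      rw [segment_succ, hstep, length_segment]
      split_ifs with hc
      · exact le_rfl
      · by_cases hi : mover (segment r n) = i
        · rw [← hi]
          exact (hQα _ _).trans ((hviable _).2 _ List.prefix_rfl (hviable _).1)
        · refine absurd ?_ hc
          rw [hact n hn, Profile.act_deviate_of_ne _ _ hi, Profile.act_ofFun, length_segment]
  have htend : Filter.Tendsto (fun n => P (segment r n)) Filter.atTop (nhds r) := by
    rw [tendsto_pi_nhds]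
    intro k
    refine tendsto_const_nhds.congr' ?_
    filter_upwards [Filter.eventually_gt_atTop k] with n hn
    rw [← (hviable (segment r n)).1 k (by simpa using hn)]
    exact (isPrefixOf_segment r n k (by simpa using hn)).symm
  refine le_of_forall_lt fun y hy => ?_
  obtain ⟨n, hn, hyn⟩ := ((Filter.eventually_ge_atTop h.length).and
    (htend.eventually (hlsc i r y hy))).exists
  exact hyn.trans_le (hmono n hn)

/-! ### Existence of an equilibrium -/

/-- The `α_ξ` of an auxiliary transfinite sequence that starts with the least payoff: `beta u ξ h`
is the largest payoff `c` of the player who moves at `h` that is either obtained at every play, or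
secured by some action `b`, in the sense that each play that is `beta u ζ`-viable at `h ++ [b]`, for
some fixed `ζ < ξ`, gives at least `c`. Only payoffs in the range of `u` are considered, so that
the supremum is attained without knowing that viable plays exist. The bound `ζ < ξ` is a separate
existential so that the termination checker can use it. -/
noncomputable def beta (u : Fin 2 → (ℕ → A) → ℝ) (ξ : Ordinal.{v}) (h : List A) : ℝ :=
  sSup {c | c ∈ Set.range (u (mover h)) ∧ ((∀ p, c ≤ u (mover h) p) ∨
    ∃ ζ, ∃ _ : ζ < ξ, ∃ b, ∀ p, IsViable u (beta u ζ) (h ++ [b]) p → c ≤ u (mover h) p)}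
termination_by ξ

/-- The action `b` at `h` secures the payoff `beta u ξ h` to the player who moves at `h`. -/
def IsSafe (u : Fin 2 → (ℕ → A) → ℝ) (ξ : Ordinal.{v}) (h : List A) (b : A) : Prop :=
  (∀ p, beta u ξ h ≤ u (mover h) p) ∨
    ∃ ζ < ξ, ∀ p, IsViable u (beta u ζ) (h ++ [b]) p → beta u ξ h ≤ u (mover h) p

/-- The payoffs of player `i` that he gets at least at all plays that are viable at `h` at some
level below `ξ`. -/
def guaranteed (u : Fin 2 → (ℕ → A) → ℝ) (ξ : Ordinal.{v}) (i : Fin 2) (h : List A) : Set ℝ :=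
  {c | c ∈ Set.range (u i) ∧ ∃ ζ < ξ, ∀ p, IsViable u (beta u ζ) h p → c ≤ u i p}

/-- `k` is obtained from `h` by an action that is safe at level `ξ`. -/
def SafeStep (u : Fin 2 → (ℕ → A) → ℝ) (ξ : Ordinal.{v}) (h k : List A) : Prop :=
  ∃ b, IsSafe u ξ h b ∧ k = h ++ [b]

section Existence

variable {u : Fin 2 → (ℕ → A) → ℝ}

theorem exists_forall_le [Nonempty A] (hfin : ∀ i, (Set.range (u i)).Finite)
    (i : Fin 2) : ∃ c ∈ Set.range (u i), ∀ p, c ≤ u i p := by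
  obtain ⟨c, hc, hmin⟩ := Set.exists_min_image _ id (hfin i) (Set.range_nonempty (u i))
  exact ⟨c, hc, fun p => hmin _ ⟨p, rfl⟩⟩

theorem isGreatest_beta [Nonempty A] (hfin : ∀ i, (Set.range (u i)).Finite)
    (ξ : Ordinal.{v}) (h : List A) :
    IsGreatest {c | c ∈ Set.range (u (mover h)) ∧ ((∀ p, c ≤ u (mover h) p) ∨
      ∃ ζ, ∃ _ : ζ < ξ, ∃ b, ∀ p, IsViable u (beta u ζ) (h ++ [b]) p → c ≤ u (mover h) p)}
      (beta u ξ h) := by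
  rw [beta]
  obtain ⟨c, hc, hmin⟩ := exists_forall_le hfin (mover h)
  have hF := (hfin (mover h)).subset fun c (hc : c ∈ {c | c ∈ Set.range (u (mover h)) ∧
    ((∀ p, c ≤ u (mover h) p) ∨ ∃ ζ, ∃ _ : ζ < ξ, ∃ b, ∀ p,
      IsViable u (beta u ζ) (h ++ [b]) p → c ≤ u (mover h) p)}) => hc.1
  exact ⟨Set.Nonempty.csSup_mem ⟨c, hc, Or.inl hmin⟩ hF, fun x hx => le_csSup hF.bddAbove hx⟩

theorem beta_mem_range [Nonempty A] (hfin : ∀ i, (Set.range (u i)).Finite)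
    (ξ : Ordinal.{v}) (h : List A) : beta u ξ h ∈ Set.range (u (mover h)) :=
  (isGreatest_beta hfin ξ h).1.1

theorem exists_isSafe [Nonempty A] (hfin : ∀ i, (Set.range (u i)).Finite)
    (ξ : Ordinal.{v}) (h : List A) : ∃ b, IsSafe u ξ h b := by
  rcases (isGreatest_beta hfin ξ h).1.2 with hp | ⟨ζ, hζ, b, hb⟩
  · exact ⟨Classical.arbitrary A, Or.inl hp⟩
  · exact ⟨b, Or.inr ⟨ζ, hζ, hb⟩⟩

theorem beta_mono [Nonempty A] (hfin : ∀ i, (Set.range (u i)).Finite) :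
    Monotone (beta u) := by
  intro ξ η hξη h
  refine (isGreatest_beta hfin η h).2 ⟨beta_mem_range hfin ξ h, ?_⟩
  rcases (isGreatest_beta hfin ξ h).1.2 with hp | ⟨ζ, hζ, b, hb⟩
  · exact Or.inl hp
  · exact Or.inr ⟨ζ, hζ.trans_le hξη, b, hb⟩

/-- Viability can be pulled back through a safe action. -/
theorem isViable_of_isSafe [Nonempty A] (hfin : ∀ i, (Set.range (u i)).Finite)
    {ξ : Ordinal.{v}} {h : List A} {b : A} (hb : IsSafe u ξ h b)
    {p : ℕ → A} (hp : IsViable u (beta u ξ) (h ++ [b]) p) : IsViable u (beta u ξ) h p := by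
  refine (isViable_append_singleton.1 ⟨hp, ?_⟩).1
  rcases hb with hb | ⟨ζ, hζ, hb⟩
  · exact hb p
  · exact hb p (hp.mono (beta_mono hfin hζ.le))

theorem guaranteed_mono_of_isSafe [Nonempty A] (hfin : ∀ i, (Set.range (u i)).Finite)
    {ξ : Ordinal.{v}} {h : List A} {b : A} (hb : IsSafe u ξ h b)
    (i : Fin 2) : guaranteed u ξ i h ⊆ guaranteed u ξ i (h ++ [b]) := by
  rintro c ⟨hc, ζ, hζ, hζc⟩
  refine ⟨hc, ?_⟩
  rcases hb with hb | ⟨ζ', hζ', hb⟩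
  · refine ⟨ζ, hζ, fun p hp => hζc p ?_⟩
    exact (isViable_append_singleton.1 ⟨hp, (beta_mono hfin hζ.le h).trans (hb p)⟩).1
  · refine ⟨max ζ ζ', max_lt hζ hζ', fun p hp => hζc p ?_⟩
    refine (isViable_append_singleton.1 ⟨hp.mono (beta_mono hfin (le_max_left _ _)), ?_⟩).1
    exact (beta_mono hfin hζ.le h).trans
      (hb p (hp.mono (beta_mono hfin (le_max_right _ _))))

theorem beta_mem_guaranteed [Nonempty A] (hfin : ∀ i, (Set.range (u i)).Finite)
    {ξ : Ordinal.{v}} (hξ : 0 < ξ) {h : List A} {b : A}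
    (hb : IsSafe u ξ h b) : beta u ξ h ∈ guaranteed u ξ (mover h) (h ++ [b]) := by
  refine ⟨beta_mem_range hfin ξ h, ?_⟩
  rcases hb with hb | ⟨ζ, hζ, hb⟩
  · exact ⟨0, hξ, fun p _ => hb p⟩
  · exact ⟨ζ, hζ, hb⟩

theorem isGreatest_guaranteed [Nonempty A] (hfin : ∀ i, (Set.range (u i)).Finite)
    {ξ : Ordinal.{v}} (hξ : 0 < ξ) (i : Fin 2) (h : List A) :
    IsGreatest (guaranteed u ξ i h) (sSup (guaranteed u ξ i h)) := by
  obtain ⟨c, hc, hmin⟩ := exists_forall_le hfin i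
  have hF : (guaranteed u ξ i h).Finite := (hfin i).subset fun c hc => hc.1
  exact ⟨Set.Nonempty.csSup_mem ⟨c, hc, 0, hξ, fun p _ => hmin p⟩ hF,
    fun x hx => le_csSup hF.bddAbove hx⟩

theorem guaranteed_mono_of_reflTransGen [Nonempty A] (hfin : ∀ i, (Set.range (u i)).Finite)
    {ξ : Ordinal.{v}} {h k : List A}
    (hk : Relation.ReflTransGen (SafeStep u ξ) h k) (i : Fin 2) :
    guaranteed u ξ i h ⊆ guaranteed u ξ i k := by
  induction hk with
  | refl => exact subset_rfl
  | tail _ hstep ih =>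
    obtain ⟨b, hb, rfl⟩ := hstep
    exact ih.trans (guaranteed_mono_of_isSafe hfin hb i)

theorem prefix_of_reflTransGen {ξ : Ordinal.{v}} {h k : List A}
    (hk : Relation.ReflTransGen (SafeStep u ξ) h k) : h <+: k := by
  induction hk with
  | refl => exact List.prefix_rfl
  | tail _ hstep ih =>
    obtain ⟨b, hb, rfl⟩ := hstep
    exact ih.trans (List.prefix_append _ _)

/-- A history between the ends of a path of safe actions lies on that path. -/
theorem reflTransGen_of_prefix {ξ : Ordinal.{v}} {h k : List A}
    (hk : Relation.ReflTransGen (SafeStep u ξ) h k) {g : List A} (hg : h <+: g) (hgk : g <+: k) :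
    Relation.ReflTransGen (SafeStep u ξ) g k := by
  induction hk with
  | refl => rw [hgk.eq_of_length_le hg.length_le]
  | tail _ hstep ih =>
    obtain ⟨b, hb, rfl⟩ := hstep
    rcases List.prefix_concat_iff.1 (by simpa using hgk) with rfl | hgk'
    · simpa using Relation.ReflTransGen.refl
    · exact (ih hgk').tail ⟨b, hb, rfl⟩

/-- Some history that is reached from `h` by safe actions has the property that further safe
actions guarantee no more to either player. -/
theorem exists_guaranteed_stable [Nonempty A] (hfin : ∀ i, (Set.range (u i)).Finite)
    {ξ : Ordinal.{v}} (hξ : 0 < ξ) (h : List A) :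
    ∃ z, Relation.ReflTransGen (SafeStep u ξ) h z ∧
      ∀ k, Relation.ReflTransGen (SafeStep u ξ) z k → ∀ i,
        sSup (guaranteed u ξ i k) = sSup (guaranteed u ξ i z) := by
  have hmem := fun (i : Fin 2) z => (isGreatest_guaranteed hfin hξ i z).1.1
  let F : List A → ℝ := fun z => sSup (guaranteed u ξ 0 z) + sSup (guaranteed u ξ 1 z)
  have hF : (F '' {z | Relation.ReflTransGen (SafeStep u ξ) h z}).Finite := by
    refine ((hfin 0).add (hfin 1)).subset ?_
    rintro _ ⟨z, -, rfl⟩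
    exact Set.add_mem_add (hmem 0 z) (hmem 1 z)
  obtain ⟨_, ⟨z, hz, rfl⟩, hmax⟩ := Set.exists_max_image _ id hF ⟨_, h, .refl, rfl⟩
  refine ⟨z, hz, fun k hk => ?_⟩
  have hle := hmax _ ⟨k, Relation.ReflTransGen.trans hz hk, rfl⟩
  have hge : ∀ i, sSup (guaranteed u ξ i z) ≤ sSup (guaranteed u ξ i k) := fun i =>
    (isGreatest_guaranteed hfin hξ i k).2
      (guaranteed_mono_of_reflTransGen hfin hk i (isGreatest_guaranteed hfin hξ i z).1)
  simp only [id, F] at hle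
  rw [Fin.forall_fin_two]
  constructor <;> linarith [hge 0, hge 1]

/-- From every history there is a viable play all of whose actions are safe. A history `z` is
reached by safe actions after which the guarantees `t i` of the two players no longer grow; these
dominate `beta u ξ` along every safe path through `z`, and hold at all plays that are viable at `z`
at some lower level `ζ`. A play of the desired kind for level `ζ` then also serves at level `ξ`. -/
theorem exists_isViable_isSafe [Nonempty A] (hfin : ∀ i, (Set.range (u i)).Finite)
    (ξ : Ordinal.{v}) (h : List A) :
    ∃ q, IsViable u (beta u ξ) h q ∧
      ∀ n, h.length ≤ n → IsSafe u ξ (segment q n) (q n) := by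
  induction ξ using WellFoundedLT.induction generalizing h with
  | ind ξ ih =>
  rcases eq_or_ne ξ 0 with rfl | hξ
  · have hmin : ∀ g p, beta u 0 g ≤ u (mover g) p := fun g p => by
      rcases (isGreatest_beta hfin 0 g).1.2 with hp | ⟨ζ, hζ, -⟩
      · exact hp p
      · exact absurd hζ (not_lt_bot)
    obtain ⟨q, hq⟩ := exists_isPrefixOf h
    exact ⟨q, ⟨hq, fun g _ _ => hmin g q⟩, fun n _ => Or.inl (hmin _)⟩
  have hξ : 0 < ξ := pos_iff_ne_zero.2 hξ
  obtain ⟨z, hz, hstable⟩ := exists_guaranteed_stable hfin hξ h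
  have hgr := fun i => isGreatest_guaranteed hfin hξ i z
  obtain ⟨ζ, hζ, hζt⟩ : ∃ ζ < ξ, ∀ p, IsViable u (beta u ζ) z p →
      ∀ i, sSup (guaranteed u ξ i z) ≤ u i p := by
    obtain ⟨-, ζ₀, h₀, ht₀⟩ := (hgr 0).1
    obtain ⟨-, ζ₁, h₁, ht₁⟩ := (hgr 1).1
    refine ⟨max ζ₀ ζ₁, max_lt h₀ h₁, fun p hp => Fin.forall_fin_two.2 ⟨?_, ?_⟩⟩
    · exact ht₀ p (hp.mono (beta_mono hfin (le_max_left _ _)))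
    · exact ht₁ p (hp.mono (beta_mono hfin (le_max_right _ _)))
  have hbound : ∀ k, Relation.ReflTransGen (SafeStep u ξ) z k →
      beta u ξ k ≤ sSup (guaranteed u ξ (mover k) z) := by
    intro k hk
    obtain ⟨b, hb⟩ := exists_isSafe hfin ξ k
    rw [← hstable _ (hk.tail ⟨b, hb, rfl⟩)]
    exact (isGreatest_guaranteed hfin hξ _ _).2 (beta_mem_guaranteed hfin hξ hb)
  obtain ⟨q, hq, hqsafe⟩ := ih ζ hζ z
  -- Along `q`, safety at level `ζ` keeps the viable plays at level `ζ` among those viable at `z`.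
  have hpath : ∀ n, z.length ≤ n → Relation.ReflTransGen (SafeStep u ξ) z (segment q n) ∧
      ∀ p, IsViable u (beta u ζ) (segment q n) p → IsViable u (beta u ζ) z p := by
    intro n hn
    induction n, hn using Nat.le_induction with
    | base => rw [isPrefixOf_iff.1 hq.1]; exact ⟨.refl, fun p hp => hp⟩
    | succ n hn ihn =>
      have hpull : ∀ p, IsViable u (beta u ζ) (segment q n ++ [q n]) p →
          IsViable u (beta u ζ) z p := fun p hp =>
        ihn.2 p (isViable_of_isSafe hfin (hqsafe n hn) hp)
      rw [segment_succ]
      refine ⟨ihn.1.tail ⟨q n, Or.inr ⟨ζ, hζ, fun p hp => ?_⟩, rfl⟩, hpull⟩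
      exact (hbound _ ihn.1).trans (hζt p (hpull p hp) _)
  have hsafe : ∀ n, z.length ≤ n → IsSafe u ξ (segment q n) (q n) := fun n hn =>
    Or.inr ⟨ζ, hζ, fun p hp => (hbound _ (hpath n hn).1).trans
      (hζt p ((hpath (n + 1) (by omega)).2 p (by rwa [segment_succ])) _)⟩
  -- The histories from `h` to `z` were left by safe actions, whose guarantees persist at `z`.
  have hbefore : ∀ g, h <+: g → IsPrefixOf g q → g.length < z.length →
      IsSafe u ξ g (q g.length) ∧ beta u ξ g ∈ guaranteed u ξ (mover g) z := by
    intro g hg hgq hlt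
    have hgz := reflTransGen_of_prefix hz hg (hgq.prefix_of_length_le hq.1 hlt.le)
    rcases hgz.cases_head with rfl | ⟨_, ⟨b, hb, rfl⟩, hbz⟩
    · exact absurd hlt (lt_irrefl _)
    · have hpre := hq.1.of_prefix (prefix_of_reflTransGen hbz)
      rw [(isPrefixOf_append_singleton.1 hpre).2]
      exact ⟨hb, guaranteed_mono_of_reflTransGen hfin hbz _ (beta_mem_guaranteed hfin hξ hb)⟩
  refine ⟨q, ⟨hq.1.of_prefix (prefix_of_reflTransGen hz), fun g hg hgq => ?_⟩, fun n hn => ?_⟩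
  · refine le_trans ?_ (hζt q hq (mover g))
    rcases lt_or_ge g.length z.length with hlt | hge
    · exact (hgr _).2 (hbefore g hg hgq hlt).2
    · have := hbound _ (hpath _ hge).1
      rwa [isPrefixOf_iff.1 hgq] at this
  · rcases lt_or_ge n z.length with hlt | hge
    · have := (hbefore (segment q n) ?_ (isPrefixOf_segment q n) (by simpa using hlt)).1
      · simpa using this
      · exact (hq.1.of_prefix (prefix_of_reflTransGen hz)).prefix_segment hn
    · exact hsafe n hge

/-- A monotone transfinite sequence in a small partial order takes the same value twice in a
row. -/
theorem exists_eq_succ {β : Type v} [PartialOrder β] {f : Ordinal.{v} → β} (hf : Monotone f) :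
    ∃ ξ, f ξ = f (ξ + 1) := by
  by_contra! hne
  refine not_injective_of_ordinal f (StrictMono.injective fun ξ η hξη => ?_)
  exact ((hf (le_add_of_nonneg_right zero_le_one)).lt_of_ne (hne ξ)).trans_le
    (hf (Order.add_one_le_of_lt hξη))

theorem exists_isSubgamePerfect [Nonempty A] [TopologicalSpace A] [DiscreteTopology A]
    (hfin : ∀ i, (Set.range (u i)).Finite) (hlsc : ∀ i, LowerSemicontinuous (u i)) :
    ∃ σ : Profile A, IsSubgamePerfect u 0 σ := by
  obtain ⟨ξ, hξ⟩ := exists_eq_succ (beta_mono hfin)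
  have hne : ∀ h, ∃ q, IsViable u (beta u ξ) h q := fun h =>
    (exists_isViable_isSafe hfin ξ h).imp fun q hq => hq.1
  obtain ⟨p, hp⟩ := hne []
  refine (exists_isSubgamePerfect_of_isViable hlsc (α := beta u ξ) (fun h a => ?_) hp).imp
    fun σ hσ => hσ.1
  obtain ⟨_, ⟨q, hq, rfl⟩, hmin⟩ := Set.exists_min_image
    (u (mover h) '' {q | IsViable u (beta u ξ) (h ++ [a]) q}) id
    ((hfin _).subset (Set.image_subset_range _ _)) (Set.Nonempty.image _ (hne _))
  refine ⟨q, hq, ?_⟩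
  rw [hξ]
  exact (isGreatest_beta hfin (ξ + 1) h).2 ⟨⟨q, rfl⟩, Or.inr ⟨ξ, lt_add_one ξ, a,
    fun p hp => hmin _ ⟨p, hp, rfl⟩⟩⟩

end Existence

/-! ### Determinacy and the value -/

section Value

variable {u : Fin 2 → (ℕ → A) → ℝ}

theorem play_eq_play_append {σ τ : Profile A} {h : List A} {a : A} (ha : τ.act h = a)
    (hστ : ∀ g, h ++ [a] <+: g → τ.act g = σ.act g) : play τ h = play σ (h ++ [a]) := by
  rw [← play_append_act τ h, ha]
  exact play_congr hστ

theorem not_append_singleton_prefix (h : List A) (a : A) : ¬ h ++ [a] <+: h := fun hp => by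
  simpa using hp.length_le

theorem mover_append_singleton_ne (h : List A) (a : A) : mover (h ++ [a]) ≠ mover h := by
  simp only [mover, List.length_append, List.length_singleton, Nat.even_add_one]
  split_ifs <;> simp_all

theorem mover_append_append (h : List A) (a b : A) : mover (h ++ [a] ++ [b]) = mover h := by
  simp [mover, Nat.even_add_one]

/-- Player `i` has a strategy that gives him at least `c` from `h` on. -/
def Forces (u : Fin 2 → (ℕ → A) → ℝ) (i : Fin 2) (c : ℝ) (h : List A) : Prop :=
  ∃ s : Strategy A i, ∀ τ : Profile A, c ≤ u i (play (τ.deviate i s) h)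

theorem Forces.of_mover {i : Fin 2} {c : ℝ} {h : List A} (hi : mover h = i) {a : A}
    (ha : Forces u i c (h ++ [a])) : Forces u i c h := by
  classical
  obtain ⟨s, hs⟩ := ha
  refine ⟨fun g => if g.1 = h then a else s g, fun τ => ?_⟩
  rw [play_eq_play_append (σ := τ.deviate i s) (a := a)]
  · exact hs τ
  · exact (Profile.act_deviate_of_eq _ _ hi).trans (if_pos rfl)
  · intro g hg
    by_cases hgi : mover g = i
    · have : g ≠ h := by rintro rfl; exact not_append_singleton_prefix _ _ hg
      exact (Profile.act_deviate_of_eq _ _ hgi).trans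
        ((if_neg this).trans (Profile.act_deviate_of_eq _ _ hgi).symm)
    · exact (Profile.act_deviate_of_ne _ _ hgi).trans
        (Profile.act_deviate_of_ne _ _ hgi).symm

/-- The strategies that force `c` after each action of the opponent are combined into one, which
reads off that action from the history. -/
theorem Forces.of_opponent [Nonempty A] {i : Fin 2} {c : ℝ} {h : List A} (hi : mover h ≠ i)
    (ha : ∀ a, Forces u i c (h ++ [a])) : Forces u i c h := by
  choose s hs using ha
  refine ⟨fun g => s (g.1.getD h.length (Classical.arbitrary A)) g, fun τ => ?_⟩
  rw [play_eq_play_append (σ := τ.deviate i (s (τ.act h))) (a := τ.act h)]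
  · exact hs _ τ
  · exact Profile.act_deviate_of_ne _ _ hi
  · intro g hg
    by_cases hgi : mover g = i
    · have : g.getD h.length (Classical.arbitrary A) = τ.act h := by
        obtain ⟨t, rfl⟩ := hg
        simp
      exact (Profile.act_deviate_of_eq _ _ hgi).trans
        ((congrArg (fun b => s b ⟨g, hgi⟩) this).trans
          (Profile.act_deviate_of_eq _ _ hgi).symm)
    · exact (Profile.act_deviate_of_ne _ _ hgi).trans
        (Profile.act_deviate_of_ne _ _ hgi).symm

/-- A player who can force `c` at a history of his has an action after which he can still force
`c`, whatever his opponent answers. -/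
theorem Forces.exists_action {c : ℝ} {h : List A} (hf : Forces u (mover h) c h) :
    ∃ a, ∀ b, Forces u (mover h) c (h ++ [a] ++ [b]) := by
  classical
  obtain ⟨s, hs⟩ := hf
  refine ⟨s ⟨h, rfl⟩, fun b => ⟨s, fun τ => ?_⟩⟩
  set k := h ++ [s ⟨h, rfl⟩] with hk
  have hki : mover k ≠ mover h := mover_append_singleton_ne _ _
  let τ' : Profile A := Profile.ofFun fun g => if g = k then b else τ.act g
  have h1 : play (τ'.deviate (mover h) s) h = play (τ'.deviate (mover h) s) k :=
    play_eq_play_append (Profile.act_deviate_of_eq _ _ rfl) fun _ _ => rfl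
  have h2 : play (τ'.deviate (mover h) s) k = play (τ.deviate (mover h) s) (k ++ [b]) := by
    refine play_eq_play_append ?_ fun g hg => ?_
    · simp [Profile.act_deviate_of_ne _ _ hki, τ']
    · by_cases hgi : mover g = mover h
      · simp [Profile.act_deviate_of_eq _ _ hgi]
      · have : g ≠ k := by rintro rfl; exact not_append_singleton_prefix _ _ hg
        simp [Profile.act_deviate_of_ne _ _ hgi, τ', this]
  rw [← h2, ← h1]
  exact hs τ'

/-- A payoff level reached at a play is guaranteed from some time on. -/
theorem exists_forall_segment_le [TopologicalSpace A] [DiscreteTopology A] {f : (ℕ → A) → ℝ}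
    (hfin : (Set.range f).Finite) (hlsc : LowerSemicontinuous f) {c : ℝ} {r : ℕ → A}
    (hc : c ≤ f r) (m : ℕ) : ∃ n, m ≤ n ∧ ∀ p, IsPrefixOf (segment r n) p → c ≤ f p := by
  by_contra! hcon
  have : Nonempty (ℕ → A) := ⟨r⟩
  choose! p hp hpc using hcon
  have hF : (Set.range f ∩ Set.Iio c).Finite := hfin.subset Set.inter_subset_left
  -- As the range is finite, there is a largest payoff `y` below `c`; a payoff above `y` is at
  -- least `c`.
  obtain ⟨y, ⟨-, hyc⟩, hy⟩ := Set.exists_max_image _ id hF ⟨f (p m), ⟨_, rfl⟩, hpc m le_rfl⟩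
  have htend : Filter.Tendsto p Filter.atTop (nhds r) := by
    rw [tendsto_pi_nhds]
    intro k
    refine tendsto_const_nhds.congr' ?_
    filter_upwards [Filter.eventually_gt_atTop k, Filter.eventually_ge_atTop m] with n hn hmn
    rw [← hp n hmn k (by simpa using hn)]
    exact (isPrefixOf_segment r n k (by simpa using hn)).symm
  obtain ⟨n, hn, hyn⟩ := ((Filter.eventually_ge_atTop m).and
    (htend.eventually (hlsc r y (lt_of_lt_of_le hyc hc)))).exists
  exact (hy _ ⟨⟨_, rfl⟩, hpc n hn⟩).not_gt hyn

/-- Determinacy: if a player cannot force `c`, his opponent can keep him below `c`, by staying at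
histories where he cannot force `c`. -/
theorem exists_forall_lt_of_not_forces [Nonempty A] [TopologicalSpace A] [DiscreteTopology A]
    {i : Fin 2} (hfin : (Set.range (u i)).Finite) (hlsc : LowerSemicontinuous (u i)) {c : ℝ}
    {h : List A} (hh : ¬ Forces u i c h) :
    ∃ τ : Profile A, ∀ s : Strategy A i, u i (play (τ.deviate i s) h) < c := by
  have hex : ∀ g, ∃ b, mover g ≠ i → ¬ Forces u i c g → ¬ Forces u i c (g ++ [b]) := by
    intro g
    by_contra! hcon
    obtain ⟨hgi, hg, -⟩ := hcon (Classical.arbitrary A)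
    exact hg (Forces.of_opponent hgi fun b => (hcon b).2.2)
  choose b hb using hex
  refine ⟨Profile.ofFun b, fun s => ?_⟩
  obtain ⟨r, hr⟩ : ∃ r, play ((Profile.ofFun b).deviate i s) h = r := ⟨_, rfl⟩
  rw [hr]
  obtain ⟨hhr, hact⟩ := play_eq_iff.1 hr
  have hnot : ∀ n, h.length ≤ n → ¬ Forces u i c (segment r n) := by
    intro n hn
    induction n, hn using Nat.le_induction with
    | base => rwa [isPrefixOf_iff.1 hhr]
    | succ n hn ih =>
      rw [segment_succ]
      by_cases hi : mover (segment r n) = i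
      · exact fun hf => ih (hf.of_mover hi)
      · rw [hact n hn, Profile.act_deviate_of_ne _ _ hi]
        exact hb _ hi ih
  by_contra! hc
  obtain ⟨n, hn, hnc⟩ := exists_forall_segment_le hfin hlsc hc h.length
  exact hnot n hn ⟨s, fun τ => hnc _ (isPrefixOf_play _ _)⟩

/-- Both players have optimal strategies: `x` is the largest payoff that player `i` can force, so
his opponent can keep him below the next larger one. -/
theorem exists_optimal [Nonempty A] [TopologicalSpace A] [DiscreteTopology A]
    {i : Fin 2} (hfin : (Set.range (u i)).Finite) (hlsc : LowerSemicontinuous (u i))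
    (h : List A) : ∃ x, Forces u i x h ∧
      ∃ τ : Profile A, ∀ s : Strategy A i, u i (play (τ.deviate i s) h) ≤ x := by
  have hF : {c | c ∈ Set.range (u i) ∧ Forces u i c h}.Finite := hfin.subset fun c hc => hc.1
  obtain ⟨m, hm, hmin⟩ := Set.exists_min_image _ id hfin (Set.range_nonempty (u i))
  let s₀ : Strategy A i := fun _ => Classical.arbitrary A
  obtain ⟨x, ⟨-, hx⟩, hmax⟩ := Set.exists_max_image _ id hF
    ⟨m, hm, s₀, fun τ => hmin _ ⟨_, rfl⟩⟩
  refine ⟨x, hx, ?_⟩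
  by_cases hne : (Set.range (u i) ∩ Set.Ioi x).Nonempty
  · obtain ⟨c, ⟨hc, hxc⟩, hcmin⟩ := Set.exists_min_image _ id
      (hfin.subset Set.inter_subset_left) hne
    obtain ⟨τ, hτ⟩ := exists_forall_lt_of_not_forces hfin hlsc (c := c) (h := h)
      fun hf => (hmax c ⟨hc, hf⟩).not_gt hxc
    refine ⟨τ, fun s => ?_⟩
    by_contra! hlt
    exact (hcmin _ ⟨⟨_, rfl⟩, hlt⟩).not_gt (hτ s)
  · refine ⟨fun j _ => Classical.arbitrary A, fun s => ?_⟩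
    by_contra! hlt
    exact hne ⟨_, ⟨_, rfl⟩, hlt⟩

theorem isValueAt_of_optimal {h : List A} {x : ℝ} (hx : Forces u (mover h) x h)
    {τ : Profile A} (hτ : ∀ s, u (mover h) (play (τ.deviate (mover h) s) h) ≤ x) :
    IsValueAt u h x := by
  obtain ⟨s, hs⟩ := hx
  have hxs : x = u (mover h) (play (τ.deviate (mover h) s) h) := le_antisymm (hs τ) (hτ s)
  refine ⟨⟨⟨s, ⟨τ, hxs⟩, ?_⟩, ?_⟩, ⟨⟨τ, ⟨s, hxs⟩, ?_⟩, ?_⟩⟩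
  · rintro _ ⟨τ', rfl⟩; exact hs τ'
  · rintro y ⟨s', hy⟩; exact (hy.2 ⟨τ, rfl⟩).trans (hτ s')
  · rintro _ ⟨s', rfl⟩; exact hτ s'
  · rintro y ⟨τ', hy⟩; exact (hs τ').trans (hy.2 ⟨s, rfl⟩)

variable [Nonempty A] [TopologicalSpace A] [DiscreteTopology A]

theorem forces_value_and_exists (hfin : ∀ i, (Set.range (u i)).Finite)
    (hlsc : ∀ i, LowerSemicontinuous (u i)) (h : List A) :
    Forces u (mover h) (value u h) h ∧
      ∃ τ : Profile A, ∀ s, u (mover h) (play (τ.deviate (mover h) s) h) ≤ value u h := by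
  obtain ⟨x, ⟨s, hs⟩, τ, hτ⟩ := exists_optimal (hfin (mover h)) (hlsc (mover h)) h
  have hbdd : ∀ s, BddBelow (Set.range fun τ : Profile A =>
      u (mover h) (play (τ.deviate (mover h) s) h)) := fun s =>
    (hfin (mover h)).bddBelow.mono (by rintro _ ⟨τ, rfl⟩; exact ⟨_, rfl⟩)
  have hle : ∀ s, ⨅ τ : Profile A, u (mover h) (play (τ.deviate (mover h) s) h) ≤ x :=
    fun s => (ciInf_le (hbdd s) τ).trans (hτ s)
  have : Nonempty (Profile A) := ⟨τ⟩
  have : Nonempty (Strategy A (mover h)) := ⟨s⟩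
  have hx : value u h = x := by
    refine le_antisymm (ciSup_le hle) ?_
    exact (le_ciInf hs).trans (le_ciSup (f := fun s : Strategy A (mover h) =>
      ⨅ τ : Profile A, u (mover h) (play (τ.deviate (mover h) s) h))
      ⟨x, by rintro _ ⟨s, rfl⟩; exact hle s⟩ s)
  rw [hx]
  exact ⟨⟨s, hs⟩, τ, hτ⟩

theorem isValueAt_value (hfin : ∀ i, (Set.range (u i)).Finite)
    (hlsc : ∀ i, LowerSemicontinuous (u i)) (h : List A) : IsValueAt u h (value u h) := by
  obtain ⟨hf, τ, hτ⟩ := forces_value_and_exists hfin hlsc h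
  exact isValueAt_of_optimal hf hτ

theorem le_value_of_forces (hfin : ∀ i, (Set.range (u i)).Finite)
    (hlsc : ∀ i, LowerSemicontinuous (u i)) {h : List A} {c : ℝ}
    (hf : Forces u (mover h) c h) : c ≤ value u h := by
  obtain ⟨-, τ, hτ⟩ := forces_value_and_exists hfin hlsc h
  obtain ⟨s, hs⟩ := hf
  exact (hs τ).trans (hτ s)

/-- The mover has an action after which every play viable for the value gives him at least the
value: a move according to an optimal strategy, since the value cannot have dropped when he moves
again. -/
theorem exists_forall_value_le (hfin : ∀ i, (Set.range (u i)).Finite)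
    (hlsc : ∀ i, LowerSemicontinuous (u i)) (h : List A) :
    ∃ a, ∀ p, IsViable u (value u) (h ++ [a]) p → value u h ≤ u (mover h) p := by
  obtain ⟨a, ha⟩ := (forces_value_and_exists hfin hlsc h).1.exists_action
  refine ⟨a, fun p hp => ?_⟩
  have hm := mover_append_append h a (p (h ++ [a]).length)
  have hle := hp.2 (h ++ [a] ++ [p (h ++ [a]).length]) (List.prefix_append _ _)
    (isPrefixOf_append_singleton.2 ⟨hp.1, rfl⟩)
  refine (le_value_of_forces hfin hlsc ?_).trans (hle.trans_eq (by rw [hm]))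
  rw [hm]
  exact ha _

end Value

/-! ### The transfinite sequence of stages -/

section Stages

variable {u : Fin 2 → (ℕ → A) → ℝ}

theorem IsSubgamePerfect.append_le {σ : Profile A} (hσ : IsSubgamePerfect u 0 σ) (h : List A)
    (a : A) : u (mover h) (play σ (h ++ [a])) ≤ u (mover h) (play σ h) := by
  classical
  let s : Strategy A (mover h) := fun g => if g.1 = h then a else σ.act g.1
  have hs := hσ h (mover h) s
  rw [sub_zero] at hs
  rwa [play_eq_play_append (σ := σ) (a := a)] at hs
  · exact (Profile.act_deviate_of_eq _ s rfl).trans (if_pos rfl)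
  · intro g hg
    by_cases hgi : mover g = mover h
    · have : g ≠ h := by rintro rfl; exact not_append_singleton_prefix _ _ hg
      rw [Profile.act_deviate_of_eq _ s hgi]
      exact if_neg this
    · rw [Profile.act_deviate_of_ne _ _ hgi]

theorem isViable_play {α : List A → ℝ} {σ : Profile A}
    (hα : ∀ g, α g ≤ u (mover g) (play σ g)) (h : List A) : IsViable u α h (play σ h) := by
  refine ⟨isPrefixOf_play σ h, fun g hg hgp => ?_⟩
  have := play_segment_play σ h hg.length_le
  rw [isPrefixOf_iff.1 hgp] at this
  rw [← this]
  exact hα g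

theorem IsSubgamePerfect.value_le [Nonempty A] [TopologicalSpace A] [DiscreteTopology A]
    (hfin : ∀ i, (Set.range (u i)).Finite) (hlsc : ∀ i, LowerSemicontinuous (u i))
    {σ : Profile A} (hσ : IsSubgamePerfect u 0 σ) (h : List A) :
    value u h ≤ u (mover h) (play σ h) := by
  obtain ⟨s, hs⟩ := (forces_value_and_exists hfin hlsc h).1
  have := hσ h (mover h) s
  rw [sub_zero] at this
  exact (hs σ).trans this

theorem le_nextAlpha (hfin : ∀ i, (Set.range (u i)).Finite) {S : Stage A}
    (hS : ∀ h, (S.2 h).Nonempty) {h : List A} {a : A} {c : ℝ}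
    (hc : ∀ p ∈ S.2 (h ++ [a]), c ≤ u (mover h) p) : c ≤ nextAlpha u S h := by
  obtain ⟨M, hM⟩ := (hfin (mover h)).bddAbove
  have hbelow : ∀ a, BddBelow (u (mover h) '' S.2 (h ++ [a])) := fun a =>
    (hfin (mover h)).bddBelow.mono (Set.image_subset_range _ _)
  refine le_trans ?_ (le_ciSup (f := fun a => sInf (u (mover h) '' S.2 (h ++ [a]))) ⟨M, ?_⟩ a)
  · exact le_csInf ((hS _).image _) (by rintro _ ⟨p, hp, rfl⟩; exact hc p hp)
  · rintro _ ⟨b, rfl⟩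
    obtain ⟨p, hp⟩ := hS (h ++ [b])
    exact (csInf_le (hbelow b) ⟨p, hp, rfl⟩).trans (hM ⟨p, rfl⟩)

theorem nextAlpha_le [Nonempty A] (hfin : ∀ i, (Set.range (u i)).Finite) {S : Stage A}
    {h : List A} {c : ℝ} (hc : ∀ a, ∃ p ∈ S.2 (h ++ [a]), u (mover h) p ≤ c) :
    nextAlpha u S h ≤ c := by
  refine ciSup_le fun a => ?_
  obtain ⟨p, hp, hpc⟩ := hc a
  exact (csInf_le ((hfin (mover h)).bddBelow.mono (Set.image_subset_range _ _))
    ⟨p, hp, rfl⟩).trans hpc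

theorem exists_le_nextAlpha (hfin : ∀ i, (Set.range (u i)).Finite) {S : Stage A}
    (hS : ∀ h, (S.2 h).Nonempty) (h : List A) (a : A) :
    ∃ p ∈ S.2 (h ++ [a]), u (mover h) p ≤ nextAlpha u S h := by
  obtain ⟨_, ⟨q, hq, rfl⟩, hmin⟩ := Set.exists_min_image (u (mover h) '' S.2 (h ++ [a])) id
    ((hfin _).subset (Set.image_subset_range _ _)) ((hS _).image _)
  exact ⟨q, hq, le_nextAlpha hfin hS fun p hp => hmin _ ⟨p, hp, rfl⟩⟩

/-- The stage `S'` refines `S`: its bounds are higher, and its sets of plays are smaller. -/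
def Refines (S S' : Stage A) : Prop := S.1 ≤ S'.1 ∧ ∀ h, S'.2 h ⊆ S.2 h

theorem Refines.refl (S : Stage A) : Refines S S := ⟨le_rfl, fun _ => subset_rfl⟩

theorem Refines.trans {S S' S'' : Stage A} (h : Refines S S') (h' : Refines S' S'') :
    Refines S S'' :=
  ⟨h.1.trans h'.1, fun g => (h'.2 g).trans (h.2 g)⟩

theorem Refines.nextAlpha_le [Nonempty A] (hfin : ∀ i, (Set.range (u i)).Finite)
    {S S' : Stage A} (hS' : ∀ h, (S'.2 h).Nonempty) (hSS' : Refines S S') :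
    nextAlpha u S ≤ nextAlpha u S' := fun h =>
  BorelGame.nextAlpha_le hfin fun a =>
    (exists_le_nextAlpha hfin hS' h a).imp fun _ hp => ⟨hSS'.2 _ hp.1, hp.2⟩

theorem Refines.nextStage [Nonempty A] (hfin : ∀ i, (Set.range (u i)).Finite)
    {S S' : Stage A} (hS' : ∀ h, (S'.2 h).Nonempty) (hSS' : Refines S S') :
    Refines (nextStage u S) (nextStage u S') := by
  have hle := hSS'.nextAlpha_le hfin hS'
  exact ⟨hle, fun h p hp =>
    ⟨Set.iUnion_mono (fun a => hSS'.2 (h ++ [a])) hp.1, (hle h).trans hp.2⟩⟩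

theorem refines_nextStage_viableStage {α : List A → ℝ}
    (hα : α ≤ nextAlpha u (viableStage u α)) :
    Refines (viableStage u α) (nextStage u (viableStage u α)) := by
  refine ⟨hα, fun h p hp => ?_⟩
  obtain ⟨a, hpa⟩ := Set.mem_iUnion.1 hp.1
  exact (isViable_append_singleton.1 ⟨hpa, (hα h).trans hp.2⟩).1

theorem stage_zero (u : Fin 2 → (ℕ → A) → ℝ) : stage u 0 = viableStage u (value u) :=
  Ordinal.limitRecOn_zero ..

theorem stage_succ (u : Fin 2 → (ℕ → A) → ℝ) (ξ : Ordinal.{v}) :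
    stage u (ξ + 1) = nextStage u (stage u ξ) :=
  Ordinal.limitRecOn_add_one ..

theorem stage_limit (u : Fin 2 → (ℕ → A) → ℝ) {ξ : Ordinal.{v}} (hξ : Order.IsSuccLimit ξ) :
    stage u ξ = viableStage u (fun h => ⨆ l : Set.Iio ξ, (stage u l.1).1 h) :=
  Ordinal.limitRecOn_limit _ _ _ _ hξ

variable [Nonempty A] [TopologicalSpace A] [DiscreteTopology A]

/-- The continuations of an equilibrium survive all stages. -/
theorem IsSubgamePerfect.mem_stage (hfin : ∀ i, (Set.range (u i)).Finite)
    (hlsc : ∀ i, LowerSemicontinuous (u i)) {σ : Profile A} (hσ : IsSubgamePerfect u 0 σ)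
    (ξ : Ordinal.{v}) :
    ∀ h, (stage u ξ).1 h ≤ u (mover h) (play σ h) ∧ play σ h ∈ (stage u ξ).2 h := by
  induction ξ using Ordinal.limitRecOn with
  | zero =>
    rw [stage_zero]
    exact fun h => ⟨hσ.value_le hfin hlsc h, isViable_play (hσ.value_le hfin hlsc) h⟩
  | add_one ξ ih =>
    have hle : ∀ h, nextAlpha u (stage u ξ) h ≤ u (mover h) (play σ h) := fun h =>
      nextAlpha_le hfin fun a => ⟨_, (ih (h ++ [a])).2, hσ.append_le h a⟩
    rw [stage_succ]
    refine fun h => ⟨hle h, Set.mem_iUnion.2 ⟨σ.act h, ?_⟩, hle h⟩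
    rw [← play_append_act]
    exact (ih _).2
  | limit ξ hξ ih =>
    have hle : ∀ h, ⨆ l : Set.Iio ξ, (stage u l.1).1 h ≤ u (mover h) (play σ h) := fun h => by
      have : Nonempty (Set.Iio ξ) := ⟨⟨0, hξ.bot_lt⟩⟩
      exact ciSup_le fun l => (ih l.1 l.2 h).1
    rw [stage_limit u hξ]
    exact fun h => ⟨hle h, isViable_play hle h⟩

theorem stage_nonempty (hfin : ∀ i, (Set.range (u i)).Finite)
    (hlsc : ∀ i, LowerSemicontinuous (u i)) (ξ : Ordinal.{v}) (h : List A) :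
    ((stage u ξ).2 h).Nonempty := by
  obtain ⟨σ, hσ⟩ := exists_isSubgamePerfect hfin hlsc
  exact ⟨_, (hσ.mem_stage hfin hlsc ξ h).2⟩

/-- The sequence of stages is monotone. At limits this needs the remark that all plays viable for
`α_ξ` belong to `H_ξ`, which is proved along with it. -/
theorem refines_stage_aux (hfin : ∀ i, (Set.range (u i)).Finite)
    (hlsc : ∀ i, LowerSemicontinuous (u i)) (ξ : Ordinal.{v}) :
    (∀ ζ ≤ ξ, Refines (stage u ζ) (stage u ξ)) ∧
      Refines (stage u ξ) (stage u (ξ + 1)) ∧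
      ∀ h p, IsViable u (stage u ξ).1 h p → p ∈ (stage u ξ).2 h := by
  have hne := stage_nonempty hfin hlsc
  induction ξ using Ordinal.limitRecOn with
  | zero =>
    refine ⟨fun ζ hζ => ?_, ?_, ?_⟩
    · rw [nonpos_iff_eq_zero.1 hζ]; exact .refl _
    · have hne := hne 0
      rw [stage_succ]
      rw [stage_zero] at hne ⊢
      refine refines_nextStage_viableStage fun h => ?_
      obtain ⟨a, ha⟩ := exists_forall_value_le hfin hlsc h
      exact le_nextAlpha hfin hne ha
    · rw [stage_zero]
      exact fun h p hp => hp
  | add_one ξ ih =>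
    obtain ⟨ih1, ih2, ih3⟩ := ih
    refine ⟨fun ζ hζ => ?_, ?_, fun h p hp => ?_⟩
    · rcases hζ.eq_or_lt with rfl | hlt
      · exact .refl _
      · exact (ih1 ζ (Order.lt_add_one_iff.1 hlt)).trans ih2
    · rw [stage_succ u (ξ + 1)]
      nth_rw 1 [stage_succ u ξ]
      exact ih2.nextStage hfin (hne _)
    · have h1 := (isViable_append_singleton.2 ⟨hp, rfl⟩)
      have h2 := ih3 _ _ (h1.1.mono ih2.1)
      have h3 := h1.2
      rw [stage_succ] at h3 ⊢
      exact ⟨Set.mem_iUnion.2 ⟨_, h2⟩, h3⟩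
  | limit ξ hξ ih =>
    obtain ⟨σ, hσ⟩ := exists_isSubgamePerfect hfin hlsc
    have hlt : ∀ ζ < ξ, Refines (stage u ζ) (stage u ξ) := by
      intro ζ hζ
      have hle : (stage u ζ).1 ≤ (stage u ξ).1 := by
        rw [stage_limit u hξ]
        intro h
        refine le_ciSup (f := fun l : Set.Iio ξ => (stage u l.1).1 h)
          ⟨u (mover h) (play σ h), ?_⟩ ⟨ζ, hζ⟩
        rintro _ ⟨l, rfl⟩
        exact (hσ.mem_stage hfin hlsc l.1 h).1
      refine ⟨hle, fun h p hp => (ih ζ hζ).2.2 h p (IsViable.mono hle ?_)⟩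
      rw [stage_limit u hξ] at hp ⊢
      exact hp
    refine ⟨fun ζ hζ => ?_, ?_, ?_⟩
    · rcases hζ.eq_or_lt with rfl | hζ
      · exact .refl _
      · exact hlt ζ hζ
    · have hle : (stage u ξ).1 ≤ nextAlpha u (stage u ξ) := by
        intro h
        have : Nonempty (Set.Iio ξ) := ⟨⟨0, hξ.bot_lt⟩⟩
        nth_rw 1 [stage_limit u hξ]
        refine ciSup_le fun l => ((ih l.1 l.2).2.1.1 h).trans ?_
        rw [stage_succ]
        exact (hlt l.1 l.2).nextAlpha_le hfin (hne _) h
      rw [stage_succ]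
      rw [stage_limit u hξ] at hle ⊢
      exact refines_nextStage_viableStage hle
    · rw [stage_limit u hξ]
      exact fun h p hp => hp

theorem refines_stage (hfin : ∀ i, (Set.range (u i)).Finite)
    (hlsc : ∀ i, LowerSemicontinuous (u i)) {ζ ξ : Ordinal.{v}} (hζξ : ζ ≤ ξ) :
    Refines (stage u ζ) (stage u ξ) :=
  (refines_stage_aux hfin hlsc ξ).1 ζ hζξ

theorem exists_isStableAt (hfin : ∀ i, (Set.range (u i)).Finite)
    (hlsc : ∀ i, LowerSemicontinuous (u i)) : ∃ ξ, IsStableAt u ξ := by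
  let f : Ordinal.{v} → (List A → ℝ) × (List A → (Set (ℕ → A))ᵒᵈ) := fun ξ =>
    (alpha u ξ, fun h => OrderDual.toDual (plays u ξ h))
  have hf : Monotone f := fun ζ ξ hζξ =>
    ⟨(refines_stage hfin hlsc hζξ).1, fun h => (refines_stage hfin hlsc hζξ).2 h⟩
  obtain ⟨ξ, hξ⟩ := exists_eq_succ hf
  exact ⟨ξ, fun h => ⟨congrFun (congrArg Prod.fst hξ) h, congrFun (congrArg Prod.snd hξ) h⟩⟩

theorem IsStableAt.isViable (hfin : ∀ i, (Set.range (u i)).Finite)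
    (hlsc : ∀ i, LowerSemicontinuous (u i)) {ξ : Ordinal.{v}} (hξ : IsStableAt u ξ)
    {h : List A} {p : ℕ → A} (hp : p ∈ plays u ξ h) : IsViable u (alpha u ξ) h p := by
  -- That plays in `H_ξ g` extend `g` is inherited from the first stage.
  have hprefix : ∀ g, p ∈ plays u ξ g → IsPrefixOf g p := fun g hg => by
    have := (refines_stage hfin hlsc (zero_le (a := ξ))).2 g hg
    rw [stage_zero] at this
    exact this.1
  have hmem : ∀ g, p ∈ plays u ξ g →
      p ∈ (⋃ a, plays u ξ (g ++ [a])) ∧ alpha u ξ g ≤ u (mover g) p := fun g hg => by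
    have h2 := (hξ g).2 ▸ hg
    have h1 := (hξ g).1
    unfold plays at h2
    unfold alpha at h1
    rw [stage_succ] at h1 h2
    exact ⟨h2.1, h1.trans_le h2.2⟩
  have hseg : ∀ n, h.length ≤ n → p ∈ plays u ξ (segment p n) := by
    intro n hn
    induction n, hn using Nat.le_induction with
    | base => rwa [isPrefixOf_iff.1 (hprefix h hp)]
    | succ n hn ih =>
      obtain ⟨a, ha⟩ := Set.mem_iUnion.1 (hmem _ ih).1
      have := (isPrefixOf_append_singleton.1 (hprefix _ ha)).2
      rw [length_segment] at this
      rwa [segment_succ, this]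
  refine ⟨hprefix h hp, fun g hg hgp => ?_⟩
  have := hseg _ hg.length_le
  rw [isPrefixOf_iff.1 hgp] at this
  exact (hmem g this).2

end Stages

end BorelGame

theorem theorem22 {A : Type*} [Nonempty A] [TopologicalSpace A] [DiscreteTopology A]
    (u : Fin 2 → (ℕ → A) → ℝ)
    (hfin : ∀ i, (Set.range (u i)).Finite)
    (hlsc : ∀ i, LowerSemicontinuous (u i)) :
    (∀ h : List A, BorelGame.IsValueAt u h (BorelGame.alpha u 0 h)) ∧
    (∀ ξ (h : List A), (BorelGame.plays u ξ h).Nonempty) ∧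
    (∃ ξ, BorelGame.IsStableAt u ξ) ∧
    ∀ ξ, BorelGame.IsStableAt u ξ → ∀ p : ℕ → A,
      (∃ σ : BorelGame.Profile A,
          BorelGame.IsSubgamePerfect u 0 σ ∧ BorelGame.play σ [] = p) ↔
        BorelGame.IsViable u (BorelGame.alpha u ξ) [] p := by
  refine ⟨fun h => ?_, BorelGame.stage_nonempty hfin hlsc,
    BorelGame.exists_isStableAt hfin hlsc, fun ξ hξ p => ⟨?_, fun hp => ?_⟩⟩
  · unfold BorelGame.alpha
    rw [BorelGame.stage_zero]
    exact BorelGame.isValueAt_value hfin hlsc h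
  · rintro ⟨σ, hσ, rfl⟩
    exact BorelGame.isViable_play (fun g => (hσ.mem_stage hfin hlsc ξ g).1) []
  · refine BorelGame.exists_isSubgamePerfect_of_isViable hlsc (fun h a => ?_) hp
    obtain ⟨q, hq, hle⟩ := BorelGame.exists_le_nextAlpha hfin
      (BorelGame.stage_nonempty hfin hlsc ξ) h a
    refine ⟨q, hξ.isViable hfin hlsc hq, hle.trans_eq ?_⟩
    rw [(hξ h).1, BorelGame.alpha, BorelGame.stage_succ, BorelGame.nextStage]
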